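/- Let $k\ge 2$ and $d\ge 0$ be integers. A deterministic finite automaton with output consists of a finite set of states, an initial state, a transition for every pair of a state and a digit from $\{0,\dots,k-1\}$, and an output attached to every state. It generates the sequence $a=(a(n))_{n\ge 0}$ if for every $n\ge0$, after reading the base-$k$ expansion of $n$ from the initial state (most significant digit first, no leading zeros, the expansion of $0$ being the empty word), it stops in a state with output $a(n)$. Call $a$ a synchronizing $k$-automatic sequence if it is generated by such an automaton that has a synchronizing word, that is, a word $w$ over $\{0,\dots,k-1\}$ and a state $t$ such that reading $w$ from any state leads to $t$. (Equivalently, the minimal automaton generating $a$ has a synchronizing word.) Let $a$ be a synchronizing $k$-automatic sequence, and let $\mathcal P_d=\{P\in\mathbb Z[X] : \deg P\le d,\ P(\mathbb N)\subseteq\mathbb N\}$, where $\mathbb N=\{0,1,2,\dots\}$. Then for every $H\ge 0$ the set $$W_H=\bigl\{(a(P(n+\ell)))_{0\le \ell<H} : n\ge 0,\ P\in\mathcal P_d\bigr\}$$ is finite, and $$\lim_{H\to\infty}\frac1H\log \# W_H=0 .$$ -/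

import Mathlib

/-- A deterministic automaton with output: it reads letters from `α`, has states `σ`, and the state
in which it stops determines an output letter from `A`. -/
structure OutputAutomaton (α σ A : Type*) where
  step : σ → α → σ
  start : σ
  output : σ → A

/-- The state reached from the state `s` after reading the word `w` from left to right. -/
def OutputAutomaton.run {α σ A : Type*} (M : OutputAutomaton α σ A) (s : σ) (w : List α) : σ :=
  w.foldl M.step s

/-- `w` is a synchronizing word for `M`: it leads every state to one and the same state. -/
def OutputAutomaton.IsSynchronizingWord {α σ A : Type*} (M : OutputAutomaton α σ A)
    (w : List α) : Prop :=
  ∃ t : σ, ∀ s : σ, M.run s w = t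

/-- The base-`k` expansion of `n`, most significant digit first, without leading zeros
(so that `0` has the empty expansion). -/
def digitWord (k : ℕ) (hk : 2 ≤ k) (n : ℕ) : List (Fin k) :=
  ((Nat.digits k n).pmap Fin.mk (fun _ hd => Nat.digits_lt_base hk hd)).reverse

/-- `M` generates `a`: on input the base-`k` expansion of `n` the output of `M` is `a n`. -/
def OutputAutomaton.Generates {k : ℕ} {σ A : Type*} (M : OutputAutomaton (Fin k) σ A)
    (hk : 2 ≤ k) (a : ℕ → A) : Prop :=
  ∀ n : ℕ, M.output (M.run M.start (digitWord k hk n)) = a n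

/-- `a` is a synchronizing `k`-automatic sequence: it is generated by a finite automaton that has
a synchronizing word.

It makes no difference whether the automaton is moreover required to be the minimal one that
generates `a`: if some automaton that generates `a` is synchronizing, then so is the minimal one,
since it is a quotient of the accessible part (after adjoining, if need be, a new initial state
that is fixed by the digit `0` and follows the old initial state on all other digits; if `w` was
synchronizing, then `1w` still is). -/
def IsSynchronizingAutomatic {A : Type*} (k : ℕ) (hk : 2 ≤ k) (a : ℕ → A) : Prop :=
  ∃ (σ : Type) (_ : Finite σ) (M : OutputAutomaton (Fin k) σ A),
    M.Generates hk a ∧ ∃ w : List (Fin k), M.IsSynchronizingWord w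

/-- The integer polynomials of degree at most `d` that map `ℕ` to `ℕ`. -/
def natValuedPolynomials (d : ℕ) : Set (Polynomial ℤ) :=
  {P | P.degree ≤ (d : WithBot ℕ) ∧ ∀ n : ℕ, 0 ≤ P.eval (n : ℤ)}

/-- The set of all words `(a(P(n)), a(P(n+1)), …, a(P(n+H-1)))` with `n ≥ 0` and `P` an integer
polynomial of degree at most `d` that maps `ℕ` to `ℕ` (so that `Int.toNat` only reads the
nonnegative integer `P(n+ℓ)` as a natural number). -/
def polynomialSubwords {A : Type*} (a : ℕ → A) (d H : ℕ) : Set (Fin H → A) :=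
  {w | ∃ n : ℕ, ∃ P ∈ natValuedPolynomials d,
    w = fun ℓ : Fin H => a (P.eval ((n + (ℓ : ℕ) : ℕ) : ℤ)).toNat}

/-!
Let `S n` be the state reached after reading `n`. Once a synchronizing word has been read, the state
depends only on the digits that follow, so `S n = S (n % k ^ m)` as soon as the `m` last digits of
`n` contain the word as a block. It is therefore enough to show that, for large `m`, all but a small
proportion of the `n` modulo `k ^ m` are such that the last `m` digits of `P n` contain the block:
then `S ∘ P` agrees with one of finitely many periodic sequences outside a set of density `δ`, and
there are at most `exp (O (δ H) + O (1))` such words of length `H`.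

A nonconstant `P` is `c + k ^ M * Q` with `c < k ^ M` and a polynomial `Q` that is not constant
modulo `k`, and appending the digits of `c` merely applies a fixed map to the state, so `P` may be
replaced by `Q`. Some prime `p ∣ k` has a bounded power that does not divide `Q'`, so `Q' u` is
divisible by a high power of `p` for few `u` only. For every other `u`, and `j` large, the upper
half of the last `2 j` digits of `Q (u + k ^ j * v)` runs through an arithmetic progression modulo
`k ^ j` as `v` varies, by Taylor's formula. Its difference `Q' u` has a small greatest common
divisor with `k ^ j`, so the leading digits are nearly equidistributed and rarely avoid the block.
-/

section DigitWords

variable {k : ℕ}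

theorem digitWord_zero (hk : 2 ≤ k) : digitWord k hk 0 = [] := by
  simp [digitWord]

theorem map_val_digitWord (hk : 2 ≤ k) (n : ℕ) :
    (digitWord k hk n).map Fin.val = (Nat.digits k n).reverse := by
  simp [digitWord, List.map_pmap]

theorem digitWord_mul_add (hk : 2 ≤ k) {n : ℕ} {c : Fin k} (h : k * n + c ≠ 0) :
    digitWord k hk (k * n + c) = digitWord k hk n ++ [c] := by
  apply List.map_injective_iff.2 Fin.val_injective
  rw [List.map_append, map_val_digitWord, map_val_digitWord,
    Nat.digits_def' (by lia) (Nat.pos_of_ne_zero h), Nat.mul_add_mod, Nat.mod_eq_of_lt c.2,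
    Nat.mul_add_div (by lia), Nat.div_eq_of_lt c.2]
  simp

theorem exists_digitWord_eq_cons (hk : 2 ≤ k) {n : ℕ} (hn : n ≠ 0) :
    ∃ c w, digitWord k hk n = c :: w ∧ (c : ℕ) ≠ 0 := by
  induction n using Nat.strong_induction_on with
  | _ n ih =>
    let c : Fin k := ⟨n % k, Nat.mod_lt _ (by lia)⟩
    have hsplit : k * (n / k) + c = n := Nat.div_add_mod n k
    have hword : digitWord k hk n = digitWord k hk (n / k) ++ [c] := by
      rw [← digitWord_mul_add hk (by rwa [hsplit]), hsplit]
    by_cases hdiv : n / k = 0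
    · refine ⟨c, [], by rw [hword, hdiv, digitWord_zero, List.nil_append], fun hc => hn ?_⟩
      rw [← hsplit, hdiv, hc, mul_zero]
    · obtain ⟨b, w, hw, hb⟩ := ih _ (Nat.div_lt_self (Nat.pos_of_ne_zero hn) hk) hdiv
      exact ⟨b, w ++ [c], by rw [hword, hw, List.cons_append], hb⟩

/-- The number whose base-`k` expansion is the one of `n` followed by the digits `w`. In particular
`appendDigits 0 w` is the number represented by `w`, where leading zeros are allowed. -/
def appendDigits (n : ℕ) (w : List (Fin k)) : ℕ :=
  w.foldl (fun m (c : Fin k) => k * m + c) n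

theorem appendDigits_eq_pow_mul_add (n : ℕ) (w : List (Fin k)) :
    appendDigits n w = k ^ w.length * n + appendDigits 0 w := by
  induction w generalizing n with
  | nil => simp [appendDigits]
  | cons c w ih =>
    calc appendDigits n (c :: w) = k ^ w.length * (k * n + c) + appendDigits 0 w := ih _
      _ = k ^ (c :: w).length * n + (k ^ w.length * (k * 0 + c) + appendDigits 0 w) := by
        rw [List.length_cons]
        ring
      _ = k ^ (c :: w).length * n + appendDigits 0 (c :: w) := congrArg _ (ih _).symm

theorem appendDigits_zero_lt (w : List (Fin k)) : appendDigits 0 w < k ^ w.length := by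
  induction w with
  | nil => simp [appendDigits]
  | cons c w ih =>
    calc appendDigits 0 (c :: w) = k ^ w.length * (k * 0 + c) + appendDigits 0 w :=
          appendDigits_eq_pow_mul_add _ w
      _ < k ^ w.length * (c + 1) := by lia
      _ ≤ k ^ w.length * k := Nat.mul_le_mul_left _ c.2
      _ = k ^ (c :: w).length := (pow_succ k w.length).symm

theorem exists_length_eq_and_appendDigits_eq {m c : ℕ} (hc : c < k ^ m) :
    ∃ w : List (Fin k), w.length = m ∧ appendDigits 0 w = c := by
  induction m generalizing c with
  | zero => exact ⟨[], rfl, (Nat.lt_one_iff.1 hc).symm⟩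
  | succ m ih =>
    have hk : 0 < k := Nat.pos_of_ne_zero (by rintro rfl; simp at hc)
    obtain ⟨w, hlength, hw⟩ := ih (Nat.div_lt_of_lt_mul (by rwa [← pow_succ'] : c < k * k ^ m))
    let digit : Fin k := ⟨c % k, Nat.mod_lt _ hk⟩
    refine ⟨w ++ [digit], by simp [hlength], ?_⟩
    calc appendDigits 0 (w ++ [digit]) = k * appendDigits 0 w + c % k := List.foldl_append
      _ = c := by rw [hw, Nat.div_add_mod]

end DigitWords

namespace OutputAutomaton

variable {k : ℕ} {σ A : Type*} (M : OutputAutomaton (Fin k) σ A)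

/-- The automaton ignores leading zeros: the digit `0` fixes the initial state. -/
def IgnoresLeadingZeros : Prop :=
  ∀ c : Fin k, (c : ℕ) = 0 → M.step M.start c = M.start

/-- The automaton `M` with a new initial state `none` that is fixed by the digit `0` and follows the
old initial state on all other digits. -/
def adjoinStart : OutputAutomaton (Fin k) (Option σ) A where
  step
    | none, c => if (c : ℕ) = 0 then none else some (M.step M.start c)
    | some s, c => some (M.step s c)
  start := none
  output s := M.output (s.getD M.start)

theorem adjoinStart_ignoresLeadingZeros : M.adjoinStart.IgnoresLeadingZeros :=
  fun _ hc => if_pos hc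

theorem adjoinStart_run_some (s : σ) (w : List (Fin k)) :
    M.adjoinStart.run (some s) w = some (M.run s w) :=
  List.foldl_hom some fun _ _ => rfl

theorem adjoinStart_run_none_cons {c : Fin k} (hc : (c : ℕ) ≠ 0) (w : List (Fin k)) :
    M.adjoinStart.run none (c :: w) = some (M.run M.start (c :: w)) :=
  calc M.adjoinStart.run none (c :: w) = M.adjoinStart.run (some (M.step M.start c)) w :=
        congrArg (M.adjoinStart.run · w) (if_neg hc)
    _ = some (M.run M.start (c :: w)) := M.adjoinStart_run_some _ w

variable {M}

theorem Generates.adjoinStart {hk : 2 ≤ k} {a : ℕ → A} (hM : M.Generates hk a) :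
    M.adjoinStart.Generates hk a := by
  intro n
  rw [← hM n]
  by_cases hn : n = 0
  · rw [hn, digitWord_zero]
    rfl
  · obtain ⟨c, w, hword, hc⟩ := exists_digitWord_eq_cons hk hn
    rw [hword]
    exact congrArg M.adjoinStart.output (M.adjoinStart_run_none_cons hc w)

theorem IsSynchronizingWord.adjoinStart_cons {w : List (Fin k)} (hw : M.IsSynchronizingWord w)
    {c : Fin k} (hc : (c : ℕ) ≠ 0) : M.adjoinStart.IsSynchronizingWord (c :: w) := by
  obtain ⟨t, ht⟩ := hw
  refine ⟨some t, fun s => ?_⟩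
  cases s with
  | none => exact (M.adjoinStart_run_none_cons hc w).trans (congrArg some (ht _))
  | some s => exact (M.adjoinStart_run_some s (c :: w)).trans (congrArg some (ht _))

end OutputAutomaton

theorem IsSynchronizingAutomatic.exists_ignoresLeadingZeros {A : Type*} {k : ℕ} {hk : 2 ≤ k}
    {a : ℕ → A} (ha : IsSynchronizingAutomatic k hk a) :
    ∃ (σ : Type) (_ : Finite σ) (M : OutputAutomaton (Fin k) σ A),
      M.Generates hk a ∧ M.IgnoresLeadingZeros ∧ ∃ w, M.IsSynchronizingWord w := by
  obtain ⟨σ, _, M, hM, w, hw⟩ := ha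
  exact ⟨Option σ, inferInstance, M.adjoinStart, hM.adjoinStart, M.adjoinStart_ignoresLeadingZeros,
    _, hw.adjoinStart_cons (c := ⟨1, hk⟩) one_ne_zero⟩

/-- The base-`k` expansion of `c` by `L` digits occurs among the last `m` base-`k` digits of `N`,
where `N` is padded by leading zeros. -/
def HasBlock (k L c m N : ℕ) : Prop :=
  ∃ i, i + L ≤ m ∧ N / k ^ i % k ^ L = c

theorem mod_pow_div_pow_mod_pow {k i L m : ℕ} (h : i + L ≤ m) (N : ℕ) :
    N % k ^ m / k ^ i % k ^ L = N / k ^ i % k ^ L := by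
  obtain ⟨e, rfl⟩ := Nat.exists_eq_add_of_le h
  rw [add_assoc, pow_add, Nat.mod_mul_right_div_self,
    Nat.mod_mod_of_dvd _ (pow_dvd_pow k (Nat.le_add_right L e))]

theorem hasBlock_mod_pow_iff {k L c m N : ℕ} :
    HasBlock k L c m (N % k ^ m) ↔ HasBlock k L c m N :=
  exists_congr fun _ => and_congr_right fun h => by rw [mod_pow_div_pow_mod_pow h]

namespace OutputAutomaton

variable {k : ℕ} {σ A : Type*} {M : OutputAutomaton (Fin k) σ A}

/-- The state in which `M` stops after reading the base-`k` expansion of `n`. -/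
def stateAt (M : OutputAutomaton (Fin k) σ A) (hk : 2 ≤ k) (n : ℕ) : σ :=
  M.run M.start (digitWord k hk n)

namespace IgnoresLeadingZeros

theorem stateAt_mul_add (hM : M.IgnoresLeadingZeros) (hk : 2 ≤ k) (n : ℕ) (c : Fin k) :
    M.stateAt hk (k * n + c) = M.step (M.stateAt hk n) c := by
  by_cases h : k * n + c = 0
  · obtain ⟨hn, hc⟩ : n = 0 ∧ (c : ℕ) = 0 := by
      simpa [show k ≠ 0 by lia] using h
    rw [h, hn, stateAt, digitWord_zero]
    exact (hM c hc).symm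
  · rw [stateAt, digitWord_mul_add hk h]
    exact List.foldl_append

theorem stateAt_appendDigits (hM : M.IgnoresLeadingZeros) (hk : 2 ≤ k) (n : ℕ)
    (w : List (Fin k)) : M.stateAt hk (appendDigits n w) = M.run (M.stateAt hk n) w :=
  (List.foldl_hom (M.stateAt hk) fun n c => (hM.stateAt_mul_add hk n c).symm).symm

theorem stateAt_pow_mul_add (hM : M.IgnoresLeadingZeros) (hk : 2 ≤ k) (n : ℕ)
    (w : List (Fin k)) :
    M.stateAt hk (k ^ w.length * n + appendDigits 0 w) = M.run (M.stateAt hk n) w := by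
  rw [← appendDigits_eq_pow_mul_add, hM.stateAt_appendDigits]

theorem exists_stateAt_pow_mul_add (hM : M.IgnoresLeadingZeros) (hk : 2 ≤ k) {m c : ℕ}
    (hc : c < k ^ m) :
    ∃ F : σ → σ, ∀ n, M.stateAt hk (k ^ m * n + c) = F (M.stateAt hk n) := by
  obtain ⟨w, rfl, rfl⟩ := exists_length_eq_and_appendDigits_eq hc
  exact ⟨(M.run · w), fun n => hM.stateAt_pow_mul_add hk n w⟩

theorem stateAt_mod_pow (hM : M.IgnoresLeadingZeros) (hk : 2 ≤ k) {w : List (Fin k)}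
    (hw : M.IsSynchronizingWord w) {m N : ℕ}
    (h : HasBlock k w.length (appendDigits 0 w) m N) :
    M.stateAt hk (N % k ^ m) = M.stateAt hk N := by
  obtain ⟨i, hi, hblock⟩ := h
  obtain ⟨t, ht⟩ := hw
  obtain ⟨F, hF⟩ := hM.exists_stateAt_pow_mul_add hk (Nat.mod_lt N (pow_pos (by lia : 0 < k) i))
  have hreset : ∀ x, x / k ^ i % k ^ w.length = appendDigits 0 w → x % k ^ i = N % k ^ i →
      M.stateAt hk x = F t := by
    intro x hx hxN
    rw [← Nat.div_add_mod x (k ^ i), hxN, hF, ← Nat.div_add_mod (x / k ^ i) (k ^ w.length), hx,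
      hM.stateAt_pow_mul_add, ht]
  rw [hreset N hblock rfl, hreset (N % k ^ m) ((mod_pow_div_pow_mod_pow hi N).trans hblock)
    (Nat.mod_mod_of_dvd N (pow_dvd_pow k (by lia)))]

theorem stateAt_eq_of_modEq (hM : M.IgnoresLeadingZeros) (hk : 2 ≤ k) {w : List (Fin k)}
    (hw : M.IsSynchronizingWord w) {m N N' : ℕ} (hmod : N ≡ N' [MOD k ^ m])
    (h : HasBlock k w.length (appendDigits 0 w) m N) : M.stateAt hk N = M.stateAt hk N' := by
  have h' : HasBlock k w.length (appendDigits 0 w) m N' := by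
    rwa [← hasBlock_mod_pow_iff, ← hmod, hasBlock_mod_pow_iff]
  rw [← hM.stateAt_mod_pow hk hw h, ← hM.stateAt_mod_pow hk hw h', hmod]

end IgnoresLeadingZeros

end OutputAutomaton

section Divisibility

theorem pow_dvd_of_pow_add_dvd_mul {M : Type*} [CommMonoidWithZero M] [IsCancelMulZero M] {p : M}
    (hp : Prime p) {n h : ℕ} {x y : M} (hx : ¬ p ^ h ∣ x) (hxy : p ^ (n + h) ∣ x * y) :
    p ^ n ∣ y := by
  rw [pow_dvd_iff_le_emultiplicity, emultiplicity_mul hp, add_comm n, Nat.cast_add] at hxy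
  rw [pow_dvd_iff_le_emultiplicity]
  by_contra! hy
  exact hxy.not_gt (ENat.add_lt_add (emultiplicity_lt_iff_not_dvd.2 hx) hy)

theorem gcd_pow_le {k p t s j : ℕ} {g : ℤ} (hk : 0 < k) (hp : p.Prime) (hpk : p ∣ k)
    (hg : ¬ (p : ℤ) ^ t ∣ g) (hj : t + k * s ≤ j + s) : Int.gcd g (k ^ (j + s) : ℕ) ≤ k ^ j := by
  set D := Int.gcd g (k ^ (j + s) : ℕ)
  obtain ⟨n, hn⟩ : D ∣ k ^ (j + s) := by
    exact_mod_cast Int.gcd_dvd_right g ((k ^ (j + s) : ℕ) : ℤ)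
  have hpD : ¬ p ^ t ∣ D := fun h =>
    hg (by exact_mod_cast (Int.natCast_dvd_natCast.2 h).trans (Int.gcd_dvd_left g _))
  have hpn : p ^ (k * s) ∣ n := by
    apply pow_dvd_of_pow_add_dvd_mul hp.prime hpD
    rw [← hn]
    exact (pow_dvd_pow p (by lia)).trans (pow_dvd_pow_of_dvd hpk _)
  have hn0 : 0 < n := Nat.pos_of_ne_zero (by rintro rfl; simp at hn; lia)
  have hks : k ^ s ≤ n := calc
    k ^ s ≤ (p ^ k) ^ s := Nat.pow_le_pow_left (Nat.lt_pow_self hp.one_lt).le s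
    _ = p ^ (k * s) := (pow_mul p k s).symm
    _ ≤ n := Nat.le_of_dvd hn0 hpn
  refine Nat.le_of_mul_le_mul_right (c := k ^ s) ?_ (pow_pos hk s)
  calc D * k ^ s ≤ D * n := Nat.mul_le_mul_left _ hks
    _ = k ^ j * k ^ s := by rw [← hn, pow_add]

end Divisibility

section Counting

theorem count_mul_eq_sum (f : ℕ → Prop) [DecidablePred f] (a b : ℕ) :
    Nat.count f (a * b) = ∑ u ∈ Finset.range a, Nat.count (fun v => f (u + a * v)) b := by
  induction b with
  | zero => simp
  | succ b ih =>
    have hlast : Nat.count (fun u => f (a * b + u)) a =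
        ∑ u ∈ Finset.range a, if f (u + a * b) then 1 else 0 := by
      simp only [Nat.count_eq_card_filter_range, Finset.card_filter, add_comm]
    rw [Nat.mul_succ, Nat.count_add, ih, hlast, ← Finset.sum_add_distrib]
    simp only [Nat.count_succ]

theorem count_mul_le_of_count_fiber_le {f g : ℕ → Prop} [DecidablePred f] [DecidablePred g]
    {a b c : ℕ} (h : ∀ u, ¬ g u → Nat.count (fun v => f (u + a * v)) b ≤ c) :
    Nat.count f (a * b) ≤ Nat.count g a * b + a * c := by
  have hfiber : ∀ u, Nat.count (fun v => f (u + a * v)) b ≤ (if g u then b else 0) + c := by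
    intro u
    split_ifs with hu
    · exact (Nat.count_le _).trans (Nat.le_add_right _ _)
    · exact (h u hu).trans (Nat.le_add_left _ _)
  calc Nat.count f (a * b) = ∑ u ∈ Finset.range a, Nat.count (fun v => f (u + a * v)) b :=
        count_mul_eq_sum f a b
    _ ≤ ∑ u ∈ Finset.range a, ((if g u then b else 0) + c) :=
        Finset.sum_le_sum fun u _ => hfiber u
    _ = Nat.count g a * b + a * c := by
        rw [Finset.sum_add_distrib, ← Finset.sum_filter, Finset.sum_const, Finset.sum_const,
          Finset.card_range, smul_eq_mul, smul_eq_mul, Nat.count_eq_card_filter_range]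

end Counting

section PolynomialRoots

open Polynomial

/-- Dividing by `X - C (x i₀)` costs at most `h` factors `p` at each of the other points. -/
theorem card_le_of_pow_dvd_eval {A : Type*} [CommRing A] [IsDomain A] {p : A} (hp : Prime p)
    {r h D : ℕ} {R : A[X]} (hR : R.natDegree ≤ D) (hr : ¬ C (p ^ r) ∣ R) {ι : Type*}
    {s : Finset ι} {x : ι → A} (hx : (s : Set ι).Pairwise fun i j => ¬ p ^ h ∣ x i - x j)
    (hs : ∀ i ∈ s, p ^ (r + h * D) ∣ R.eval (x i)) : s.card ≤ D := by
  classical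
  induction D generalizing R s with
  | zero =>
    rw [Nat.le_zero, Finset.card_eq_zero, Finset.eq_empty_iff_forall_notMem]
    intro i hi
    rw [eq_C_of_natDegree_le_zero hR] at hr hs
    exact hr (map_dvd C (by simpa using hs i hi))
  | succ D ih =>
    rcases s.eq_empty_or_nonempty with rfl | ⟨i₀, hi₀⟩
    · simp
    set T := R /ₘ (X - C (x i₀))
    have hdiv : R = C (R.eval (x i₀)) + (X - C (x i₀)) * T := by
      rw [← modByMonic_X_sub_C_eq_C_eval, modByMonic_add_div]
    have hTdeg : T.natDegree ≤ D := by
      rw [natDegree_divByMonic _ (monic_X_sub_C _), natDegree_X_sub_C]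
      lia
    have hTr : ¬ C (p ^ r) ∣ T := by
      intro hdvd
      apply hr
      rw [hdiv]
      exact dvd_add (map_dvd C ((pow_dvd_pow p (Nat.le_add_right _ _)).trans (hs i₀ hi₀)))
        (hdvd.mul_left _)
    have hTs : ∀ i ∈ s.erase i₀, p ^ (r + h * D) ∣ T.eval (x i) := by
      intro i hi
      obtain ⟨hne, his⟩ := Finset.mem_erase.1 hi
      have heval : R.eval (x i) - R.eval (x i₀) = (x i - x i₀) * T.eval (x i) := by
        conv_lhs => rw [hdiv]
        simp
      apply pow_dvd_of_pow_add_dvd_mul hp (hx his hi₀ hne)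
      rw [← heval, add_assoc, ← Nat.mul_succ]
      exact dvd_sub (hs i his) (hs i₀ hi₀)
    have hcard := ih hTdeg hTr (hx.mono (Finset.coe_subset.2 (Finset.erase_subset i₀ s))) hTs
    rw [Finset.card_erase_of_mem hi₀] at hcard
    lia

theorem count_pow_dvd_eval_le {p : ℕ} (hp : p.Prime) {r D : ℕ} {R : ℤ[X]}
    (hR : R.natDegree ≤ D) (hr : ¬ C ((p : ℤ) ^ r) ∣ R) (h N : ℕ) :
    Nat.count (fun u : ℕ => (p : ℤ) ^ (r + h * D) ∣ R.eval (u : ℤ)) (p ^ h * N) ≤ D * N := by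
  classical
  set f : ℕ → Prop := fun u => (p : ℤ) ^ (r + h * D) ∣ R.eval (u : ℤ)
  set g : ℕ → Prop := fun u => ∃ v, f (u + p ^ h * v)
  have hclasses : Nat.count g (p ^ h) ≤ D := by
    rw [Nat.count_eq_card_filter_range]
    choose! v hv using fun u (hu : u ∈ {u ∈ Finset.range (p ^ h) | g u}) =>
      (Finset.mem_filter.1 hu).2
    refine card_le_of_pow_dvd_eval (Nat.prime_iff_prime_int.1 hp) hR hr
      (x := fun u => ((u + p ^ h * v u : ℕ) : ℤ)) (fun i hi j hj hne hdvd => hne ?_) hv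
    have hmod : j + p ^ h * v j ≡ i + p ^ h * v i [MOD p ^ h] :=
      Nat.modEq_iff_dvd.2 (by exact_mod_cast hdvd)
    have hmod' : j ≡ i [MOD p ^ h] := by simpa [Nat.ModEq] using hmod
    simp only [Finset.coe_filter, Finset.mem_range, Set.mem_ofPred_eq] at hi hj
    exact (hmod'.eq_of_lt_of_lt hj.1 hi.1).symm
  calc Nat.count f (p ^ h * N) ≤ Nat.count g (p ^ h) * N + p ^ h * 0 :=
        count_mul_le_of_count_fiber_le fun u hu =>
          (Nat.count_of_forall_not fun v _ hv => hu ⟨v, hv⟩).le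
    _ ≤ D * N := Nat.mul_le_mul_right N hclasses

end PolynomialRoots

section ArithmeticProgressions

theorem card_le_of_ediv_eq_of_modEq {B D : ℕ} (hB : 0 < B) (hD : 0 < D) {s : Finset ℤ} {y : ℤ}
    (hy : ∀ x ∈ s, x / B = y) (hmod : ∀ x ∈ s, ∀ x' ∈ s, x ≡ x' [ZMOD D]) :
    s.card ≤ B / D + 1 := by
  have hB' : (0 : ℤ) < B := by exact_mod_cast hB
  have hrange : ∀ x ∈ s, x % B / D ∈ Finset.Ico (0 : ℤ) (B / D + 1) := fun x _ => by
    rw [Finset.mem_Ico, Int.lt_add_one_iff]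
    exact ⟨Int.ediv_nonneg (Int.emod_nonneg x hB'.ne') (by lia),
      Int.ediv_le_ediv (by exact_mod_cast hD) (Int.emod_lt_of_pos x hB').le⟩
  have hinj : Set.InjOn (fun x : ℤ => x % B / D) s := by
    intro x hx x' hx' (hdiv : x % B / D = x' % B / D)
    have hmod' : x % B % D = x' % B % D := by
      apply Int.ModEq.add_left_cancel' (B * y)
      nth_rewrite 1 [← hy x hx, ← hy x' hx']
      rw [Int.mul_ediv_add_emod, Int.mul_ediv_add_emod]
      exact hmod x hx x' hx'
    rw [← Int.mul_ediv_add_emod x B, ← Int.mul_ediv_add_emod x' B, hy x hx, hy x' hx',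
      ← Int.mul_ediv_add_emod (x % B) D, ← Int.mul_ediv_add_emod (x' % B) D, hdiv, hmod']
  calc s.card ≤ (Finset.Ico (0 : ℤ) (B / D + 1)).card :=
        Finset.card_le_card_of_injOn _ hrange hinj
    _ = B / D + 1 := by
        rw [Int.card_Ico, sub_zero]
        norm_cast

theorem card_filter_add_mul_emod_eq_le {m : ℕ} (hm : 0 < m) (a g x : ℤ) :
    {v ∈ Finset.range m | (a + (v : ℕ) * g) % m = x}.card ≤ Int.gcd g m := by
  obtain ⟨m', hm'⟩ : Int.gcd g m ∣ m := by exact_mod_cast Int.gcd_dvd_right g (m : ℤ)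
  have hgcd : (m : ℤ) / Int.gcd m g = m' := by
    have hpos : 0 < Int.gcd g m := Int.gcd_pos_of_ne_zero_right _ (by exact_mod_cast hm.ne')
    rw [Int.gcd_comm]
    exact Int.ediv_eq_of_eq_mul_right (by exact_mod_cast hpos.ne') (by exact_mod_cast hm')
  rw [← Finset.card_range (Int.gcd g m)]
  refine Finset.card_le_card_of_injOn (· / m') (fun v hv => ?_) fun v hv w hw hdiv => ?_
  · rw [Finset.mem_coe, Finset.mem_filter, Finset.mem_range] at hv
    exact Finset.mem_coe.2 (Finset.mem_range.2 (Nat.div_lt_of_lt_mul (by lia)))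
  · rw [Finset.mem_coe, Finset.mem_filter] at hv hw
    have hmul : (v : ℤ) * g ≡ w * g [ZMOD m] :=
      Int.ModEq.add_left_cancel' a (hv.2.trans hw.2.symm)
    have hmod : v ≡ w [MOD m'] := by
      rw [← Int.natCast_modEq_iff, ← hgcd]
      exact hmul.cancel_right_div_gcd (by exact_mod_cast hm)
    rw [← Nat.div_add_mod v m', ← Nat.div_add_mod w m', show v / m' = w / m' from hdiv, hmod]

theorem count_ediv_eq_le {m : ℕ} (hm : 0 < m) {B : ℕ} (hB : 0 < B) (a g y : ℤ) :
    Nat.count (fun v : ℕ => (a + v * g) % m / B = y) m ≤ B + Int.gcd g m := by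
  set D := Int.gcd g m
  have hD : 0 < D := Int.gcd_pos_of_ne_zero_right _ (by exact_mod_cast hm.ne')
  set value : ℕ → ℤ := fun v => (a + v * g) % m
  set s := {v ∈ Finset.range m | value v / B = y}
  have hmod : ∀ v, value v ≡ a [ZMOD D] := by
    intro v
    refine ((Int.mod_modEq _ _).of_dvd (Int.gcd_dvd_right g m)).trans ?_
    exact Int.modEq_iff_dvd.2 (by simpa using (Int.gcd_dvd_left g (m : ℤ)).mul_left _)
  have himage : (s.image value).card ≤ B / D + 1 := by
    refine card_le_of_ediv_eq_of_modEq hB hD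
      (Finset.forall_mem_image.2 fun v hv => (Finset.mem_filter.1 hv).2) ?_
    simp only [Finset.forall_mem_image]
    exact fun v _ w _ => (hmod v).trans (hmod w).symm
  have hfiber : ∀ x ∈ s.image value, {v ∈ s | value v = x}.card ≤ D := fun x _ =>
    (Finset.card_le_card (Finset.filter_subset_filter _ (Finset.filter_subset _ _))).trans
      (card_filter_add_mul_emod_eq_le hm a g x)
  calc Nat.count (fun v : ℕ => value v / B = y) m = s.card := Nat.count_eq_card_filter_range _ _
    _ ≤ D * (s.image value).card := Finset.card_le_mul_card_image s D hfiber
    _ ≤ D * (B / D + 1) := Nat.mul_le_mul_left D himage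
    _ ≤ B + D := by
        rw [mul_add, mul_one]
        exact Nat.add_le_add_right (Nat.mul_div_le B D) D

end ArithmeticProgressions

section BlockFreePolynomialValues

open Polynomial

/-- The numbers below `b ^ q` all of whose `q` base-`b` digits, with leading zeros, differ
from `c`. -/
def digitAvoiders (b c q : ℕ) : Finset ℕ :=
  {y ∈ Finset.range (b ^ q) | ∀ i < q, y / b ^ i % b ≠ c}

theorem card_digitAvoiders_le {b c : ℕ} (hc : c < b) (q : ℕ) :
    (digitAvoiders b c q).card ≤ (b - 1) ^ q := by
  induction q with
  | zero => exact (Finset.card_filter_le _ _).trans (by simp)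
  | succ q ih =>
    calc (digitAvoiders b c (q + 1)).card
        ≤ (digitAvoiders b c q ×ˢ (Finset.range b).erase c).card := by
          refine Finset.card_le_card_of_injOn (fun y => (y / b, y % b)) ?_ ?_
          · intro y hy
            simp only [digitAvoiders, Finset.coe_filter, Finset.mem_range,
              Set.mem_ofPred_eq] at hy
            simp only [digitAvoiders, Finset.coe_product, Set.mem_prod, Finset.coe_filter,
              Finset.mem_range, Set.mem_ofPred_eq, Finset.mem_coe, Finset.mem_erase]
            refine ⟨⟨Nat.div_lt_of_lt_mul (by rw [← pow_succ']; exact hy.1), fun i hi => ?_⟩,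
              by simpa using hy.2 0 (Nat.succ_pos q), Nat.mod_lt _ (by lia)⟩
            rw [Nat.div_div_eq_div_mul, ← pow_succ']
            exact hy.2 (i + 1) (Nat.succ_lt_succ hi)
          · intro x _ y _ hxy
            obtain ⟨hdiv, hmod⟩ := Prod.mk.inj hxy
            rw [← Nat.div_add_mod x b, ← Nat.div_add_mod y b, hdiv, hmod]
      _ ≤ (b - 1) ^ (q + 1) := by
          rw [Finset.card_product, Finset.card_erase_of_mem (Finset.mem_range.2 hc),
            Finset.card_range, pow_succ]
          exact Nat.mul_le_mul_right _ ih

theorem div_mod_mem_digitAvoiders {k L c q i m N : ℕ} (hk : 0 < k) (hm : i + L * q ≤ m)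
    (h : ¬ HasBlock k L c m N) : N / k ^ i % k ^ (L * q) ∈ digitAvoiders (k ^ L) c q := by
  rw [digitAvoiders, Finset.mem_filter, Finset.mem_range, ← pow_mul]
  refine ⟨Nat.mod_lt _ (pow_pos hk _), fun a ha heq => h ⟨i + L * a, ?_, ?_⟩⟩
  · have : L * (a + 1) ≤ L * q := Nat.mul_le_mul_left L ha
    lia
  · have hle : L * a + L ≤ L * q := Nat.mul_le_mul_left L ha
    rwa [← pow_mul, mod_pow_div_pow_mod_pow hle, Nat.div_div_eq_div_mul, ← pow_add] at heq

theorem eval_add_mul_ediv_modEq (Q : ℤ[X]) (u v : ℤ) {m : ℤ} (hm : m ≠ 0) :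
    Q.eval (u + m * v) / m ≡ Q.eval u / m + v * (derivative Q).eval u [ZMOD m] := by
  obtain ⟨e, he⟩ := Q.binomExpansion u (m * v)
  have hexpand : Q.eval (u + m * v) =
      Q.eval u + m * (v * (derivative Q).eval u + m * (e * v ^ 2)) := by
    rw [he]
    ring
  rw [hexpand, Int.add_mul_ediv_left _ _ hm, ← add_assoc]
  exact Int.modEq_iff_dvd.2 ⟨-(e * v ^ 2), by ring⟩

/-- Put `m = k ^ (e + L * q)`. Modulo `m`, the numbers `f (u + m * v) / m` form an arithmetic
progression in `v` whose difference is nearly prime to `m`, while the `L * q` leading digits of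
such a number, within the window, avoid a block of digits. -/
theorem count_not_hasBlock_add_mul_le {k L c p t q e : ℕ} (hk : 0 < k) (hc : c < k ^ L)
    (hp : p.Prime) (hpk : p ∣ k) {Q : ℤ[X]} {f : ℕ → ℕ} (hf : ∀ n : ℕ, (f n : ℤ) = Q.eval (n : ℤ))
    {u : ℕ} (hu : ¬ (p : ℤ) ^ t ∣ (derivative Q).eval (u : ℤ))
    (he : t + k * (L * q) ≤ e + L * q) [DecidablePred (HasBlock k L c (2 * (e + L * q)))] :
    Nat.count (fun v => ¬ HasBlock k L c (2 * (e + L * q)) (f (u + k ^ (e + L * q) * v)))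
      (k ^ (e + L * q)) ≤ (k ^ L - 1) ^ q * (2 * k ^ e) := by
  set m := k ^ (e + L * q) with hm
  have hmpos : 0 < m := pow_pos hk _
  set a := Q.eval (u : ℤ) / m
  set g := (derivative Q).eval (u : ℤ)
  have hdigits : ∀ v : ℕ, ((f (u + m * v) / k ^ (e + L * q + e) % k ^ (L * q) : ℕ) : ℤ) =
      (a + v * g) % m / (k ^ e : ℕ) := by
    intro v
    have hmod := eval_add_mul_ediv_modEq Q u v (m := m) (by exact_mod_cast hmpos.ne')
    rw [← hmod.eq]
    have hcast : Q.eval ((u : ℤ) + m * v) = (f (u + m * v) : ℕ) := by rw [hf]; push_cast; rfl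
    rw [hcast, pow_add, ← Nat.div_div_eq_div_mul, ← hm, ← Nat.mod_mul_right_div_self, ← pow_add,
      ← hm]
    norm_cast
  rw [Nat.count_eq_card_filter_range]
  calc _ ≤ ((digitAvoiders (k ^ L) c q).biUnion fun y =>
        {v ∈ Finset.range m | (a + (v : ℕ) * g) % m / (k ^ e : ℕ) = y}).card := by
        refine Finset.card_le_card fun v hv => ?_
        rw [Finset.mem_filter] at hv
        exact Finset.mem_biUnion.2 ⟨_, div_mod_mem_digitAvoiders hk (by lia) hv.2,
          Finset.mem_filter.2 ⟨hv.1, (hdigits v).symm⟩⟩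
    _ ≤ (digitAvoiders (k ^ L) c q).card * (2 * k ^ e) := by
        refine Finset.card_biUnion_le_card_mul _ _ _ fun y _ => ?_
        rw [← Nat.count_eq_card_filter_range]
        have hgcd := gcd_pow_le hk hp hpk hu he
        exact (count_ediv_eq_le hmpos (pow_pos hk e) a g y).trans (by lia)
    _ ≤ _ := Nat.mul_le_mul_right _ (card_digitAvoiders_le hc q)

theorem count_not_hasBlock_le {k L c p r h d q e : ℕ} (hk : 0 < k) (hc : c < k ^ L)
    (hp : p.Prime) (hpk : p ∣ k) {Q : ℤ[X]} {f : ℕ → ℕ} (hf : ∀ n : ℕ, (f n : ℤ) = Q.eval (n : ℤ))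
    (hd : Q.natDegree ≤ d) (hr : ¬ C ((p : ℤ) ^ r) ∣ derivative Q) (he : h ≤ e + L * q)
    (he' : r + h * d + k * (L * q) ≤ e + L * q)
    [DecidablePred (HasBlock k L c (2 * (e + L * q)))] :
    Nat.count (fun n => ¬ HasBlock k L c (2 * (e + L * q)) (f n)) (k ^ (2 * (e + L * q))) * 2 ^ h ≤
      d * k ^ (2 * (e + L * q)) +
        k ^ (e + L * q) * ((k ^ L - 1) ^ q * (2 * k ^ e)) * 2 ^ h := by
  set m := k ^ (e + L * q)
  set bad : ℕ → Prop := fun n => ¬ HasBlock k L c (2 * (e + L * q)) (f n)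
  set root : ℕ → Prop := fun u => (p : ℤ) ^ (r + h * d) ∣ (derivative Q).eval (u : ℤ)
  set b := (k ^ L - 1) ^ q * (2 * k ^ e)
  have hroots : Nat.count root m * 2 ^ h ≤ d * m := by
    obtain ⟨N, hN⟩ : p ^ h ∣ m := (pow_dvd_pow_of_dvd hpk h).trans (pow_dvd_pow k he)
    have hdeg : (derivative Q).natDegree ≤ d := (natDegree_derivative_le Q).trans (by lia)
    calc Nat.count root m * 2 ^ h ≤ d * N * p ^ h := by
          rw [hN]
          exact Nat.mul_le_mul (count_pow_dvd_eval_le hp hdeg hr h N)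
            (Nat.pow_le_pow_left hp.two_le h)
      _ = d * m := by rw [hN]; ring
  have hcount : Nat.count bad (m * m) ≤ Nat.count root m * m + m * b :=
    count_mul_le_of_count_fiber_le fun _ hu =>
      count_not_hasBlock_add_mul_le hk hc hp hpk hf hu he'
  have hsq : k ^ (2 * (e + L * q)) = m * m := by rw [two_mul, pow_add]
  rw [hsq]
  calc Nat.count bad (m * m) * 2 ^ h ≤ (Nat.count root m * m + m * b) * 2 ^ h :=
        Nat.mul_le_mul_right _ hcount
    _ = Nat.count root m * 2 ^ h * m + m * b * 2 ^ h := by ring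
    _ ≤ d * m * m + m * b * 2 ^ h := by gcongr
    _ = d * (m * m) + m * b * 2 ^ h := by ring

end BlockFreePolynomialValues

section PolynomialReduction

open Polynomial

theorem exists_prime_not_dvd_derivative {k d : ℕ} (hk : k ≠ 0) {Q : ℤ[X]} (hd : Q.natDegree ≤ d)
    {i : ℕ} (hi : i ≠ 0) (hQ : ¬ (k : ℤ) ∣ Q.coeff i) :
    ∃ p : ℕ, p.Prime ∧ p ∣ k ∧ ¬ C ((p : ℤ) ^ (k + d)) ∣ derivative Q := by
  obtain ⟨i, rfl⟩ := Nat.exists_eq_succ_of_ne_zero hi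
  have hid : i + 1 ≤ d :=
    (le_natDegree_of_ne_zero fun h => hQ (h ▸ dvd_zero (k : ℤ))).trans hd
  rw [← Int.dvd_natAbs, Int.natCast_dvd_natCast, Nat.dvd_iff_prime_pow_dvd_dvd] at hQ
  push Not at hQ
  obtain ⟨p, e, hp, hpk, hpQ⟩ := hQ
  have he : e ≠ 0 := by
    rintro rfl
    simp at hpQ
  have hek : e ≤ k :=
    (Nat.lt_pow_self hp.one_lt).le.trans (Nat.le_of_dvd (Nat.pos_of_ne_zero hk) hpk)
  refine ⟨p, hp, (dvd_pow_self p he).trans hpk, fun h => hpQ ?_⟩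
  have hcoeff := (C_dvd_iff_dvd_coeff _ _).1 h i
  rw [coeff_derivative, mul_comm] at hcoeff
  have hpi : ¬ (p : ℤ) ^ d ∣ (i : ℤ) + 1 := by
    intro hdvd
    have hle : p ^ d ≤ i + 1 := Nat.le_of_dvd i.succ_pos (by exact_mod_cast hdvd)
    exact (Nat.lt_pow_self hp.one_lt).not_ge (hle.trans hid)
  rw [← Int.natCast_dvd_natCast, Int.dvd_natAbs, Nat.cast_pow]
  exact (pow_dvd_pow _ hek).trans
    (pow_dvd_of_pow_add_dvd_mul (Nat.prime_iff_prime_int.1 hp) hpi hcoeff)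

theorem exists_eq_C_add_C_pow_mul {k : ℕ} (hk : 2 ≤ k) {P : ℤ[X]} (hP : P.natDegree ≠ 0) :
    ∃ (M c : ℕ) (Q : ℤ[X]), c < k ^ M ∧ P = C (c : ℤ) + C ((k : ℤ) ^ M) * Q ∧
      ∃ i, i ≠ 0 ∧ ¬ (k : ℤ) ∣ Q.coeff i := by
  have hfin : FiniteMultiplicity (C (k : ℤ)) P.divX := by
    refine .of_not_isUnit (fun h => ?_) fun h => hP ?_
    · have := Int.isUnit_iff.1 (isUnit_C.1 h)
      lia
    · rw [divX_eq_zero_iff.1 h, natDegree_C]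
  obtain ⟨T, hT, hkT⟩ := hfin.exists_eq_pow_mul_and_not_dvd
  set M := multiplicity (C (k : ℤ)) P.divX
  have hkM : 0 < (k : ℤ) ^ M := by positivity
  have hc : (((P.coeff 0 % (k : ℤ) ^ M).toNat : ℕ) : ℤ) = P.coeff 0 % (k : ℤ) ^ M :=
    Int.toNat_of_nonneg (Int.emod_nonneg _ hkM.ne')
  refine ⟨M, (P.coeff 0 % (k : ℤ) ^ M).toNat, T * X + C (P.coeff 0 / (k : ℤ) ^ M), ?_, ?_, ?_⟩
  · zify
    rw [hc]
    exact Int.emod_lt_of_pos _ hkM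
  · conv_lhs => rw [← divX_mul_X_add P, hT, ← Int.emod_add_mul_ediv (P.coeff 0) ((k : ℤ) ^ M)]
    rw [hc]
    simp only [C_add, C_mul, C_pow]
    ring
  · rw [C_dvd_iff_dvd_coeff, not_forall] at hkT
    obtain ⟨i, hi⟩ := hkT
    exact ⟨i + 1, i.succ_ne_zero, by rwa [coeff_add, coeff_mul_X, coeff_C_succ, add_zero]⟩

theorem mem_natValuedPolynomials_of_C_add_C_mul {b c d : ℕ} (hc : c < b) {Q : ℤ[X]}
    (h : C (c : ℤ) + C (b : ℤ) * Q ∈ natValuedPolynomials d) : Q ∈ natValuedPolynomials d := by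
  have hb : (0 : ℤ) < b := by lia
  refine ⟨?_, fun n => ?_⟩
  · rw [← degree_C_mul hb.ne', ← add_sub_cancel_left (C (c : ℤ)) (C (b : ℤ) * Q)]
    exact (degree_sub_le _ _).trans
      (max_le h.1 (degree_C_le.trans (by exact_mod_cast Nat.zero_le d)))
  · have hn := h.2 n
    rw [eval_add, eval_mul, eval_C, eval_C] at hn
    by_contra! hneg
    nlinarith

theorem comp_X_add_C_mem_natValuedPolynomials {d : ℕ} {P : ℤ[X]} (hP : P ∈ natValuedPolynomials d)
    (n : ℕ) : P.comp (X + C (n : ℤ)) ∈ natValuedPolynomials d := by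
  refine ⟨degree_le_of_natDegree_le ?_, fun m => ?_⟩
  · rw [natDegree_comp, natDegree_X_add_C, mul_one]
    exact natDegree_le_of_degree_le hP.1
  · simpa using hP.2 (m + n)

end PolynomialReduction

section Density

open Polynomial

theorem exists_pow_add_pow_le {x : ℝ} (hx : 0 ≤ x) (hx1 : x < 1) (d : ℝ) {δ : ℝ} (hδ : 0 < δ) :
    ∃ h q : ℕ, d * (1 / 2) ^ h + 2 * x ^ q ≤ δ := by
  have hlim : Filter.Tendsto (fun n : ℕ => d * (1 / 2 : ℝ) ^ n + 2 * x ^ n) Filter.atTop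
      (nhds (d * 0 + 2 * 0)) :=
    ((tendsto_pow_atTop_nhds_zero_of_lt_one (by norm_num) (by norm_num)).const_mul d).add
      ((tendsto_pow_atTop_nhds_zero_of_lt_one hx hx1).const_mul 2)
  rw [mul_zero, mul_zero, add_zero] at hlim
  obtain ⟨n, hn⟩ := (hlim.eventually_lt_const hδ).exists
  exact ⟨n, n, hn.le⟩

open scoped Classical in
theorem exists_count_not_hasBlock_le {k L c : ℕ} (hk : 0 < k) (hc : c < k ^ L) (d : ℕ) {δ : ℝ}
    (hδ : 0 < δ) :
    ∃ m : ℕ, ∀ (Q : ℤ[X]) (f : ℕ → ℕ), (∀ n : ℕ, (f n : ℤ) = Q.eval (n : ℤ)) → Q.natDegree ≤ d →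
      (∃ i, i ≠ 0 ∧ ¬ (k : ℤ) ∣ Q.coeff i) →
        (Nat.count (fun n => ¬ HasBlock k L c m (f n)) (k ^ m) : ℝ) ≤ δ * (k ^ m : ℕ) := by
  have hkL : (1 : ℝ) ≤ (k : ℝ) ^ L := one_le_pow₀ (by exact_mod_cast hk)
  obtain ⟨h, q, hhq⟩ := exists_pow_add_pow_le (x := 1 - 1 / (k : ℝ) ^ L)
    (sub_nonneg.2 ((div_le_one (by positivity)).2 hkL)) (sub_lt_self _ (by positivity)) d hδ
  set e := k + d + h * d + k * (L * q) + h
  refine ⟨2 * (e + L * q), fun Q f hf hd ⟨i, hi, hik⟩ => ?_⟩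
  obtain ⟨p, hp, hpk, hpQ⟩ := exists_prime_not_dvd_derivative hk.ne' hd hi hik
  have hcount := count_not_hasBlock_le (h := h) (q := q) (e := e) hk hc hp hpk hf hd hpQ
    (by lia) (by lia)
  have havoid : (((k ^ L - 1 : ℕ) : ℝ)) ^ q = (1 - 1 / (k : ℝ) ^ L) ^ q * (k ^ L) ^ q := by
    rw [← mul_pow, sub_mul, one_mul, one_div_mul_cancel (by positivity),
      Nat.cast_pred (pow_pos hk L), Nat.cast_pow]
  refine le_of_mul_le_mul_right ?_ (pow_pos two_pos h)
  calc _ ≤ (d * (k : ℝ) ^ (2 * (e + L * q)) + k ^ (e + L * q) *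
          (((k ^ L - 1 : ℕ) : ℝ) ^ q * (2 * k ^ e)) * 2 ^ h) := by exact_mod_cast hcount
    _ = (d * (1 / 2) ^ h + 2 * (1 - 1 / (k : ℝ) ^ L) ^ q) *
          (k ^ (2 * (e + L * q)) : ℕ) * 2 ^ h := by
        have hhalf : (1 / 2 : ℝ) ^ h * 2 ^ h = 1 := by rw [← mul_pow]; norm_num
        rw [havoid]
        push_cast
        linear_combination (-d * (k : ℝ) ^ (2 * (e + L * q))) * hhalf
    _ ≤ _ := by gcongr

end Density

section AlmostPeriodicity

variable {σ : Type*}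

/-- The sequences in `𝒮` are rationally almost periodic, uniformly: for every `δ > 0` there is one
period `K` such that each of them agrees with a `K`-periodic sequence outside a union of at most
`δ * K` residue classes modulo `K`. -/
def IsUniformlyRationallyAlmostPeriodic (𝒮 : Set (ℕ → σ)) : Prop :=
  ∀ δ : ℝ, 0 < δ → ∃ K : ℕ, 0 < K ∧ ∀ s ∈ 𝒮, ∃ (u : ZMod K → σ) (T : Set (ZMod K)),
    (T.ncard : ℝ) ≤ δ * K ∧ ∀ n : ℕ, (n : ZMod K) ∉ T → s n = u n

/-- The initial words of length `H` of the sequences in `𝒮`. -/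
def initialWords (𝒮 : Set (ℕ → σ)) (H : ℕ) : Set (Fin H → σ) :=
  (fun s ℓ => s ℓ) '' 𝒮

theorem ncard_setOf_eqOn_compl_le {ι : Type*} [Finite ι] [Finite σ] (u : ι → σ) (T : Set ι) :
    {w : ι → σ | Set.EqOn w u Tᶜ}.ncard ≤ Nat.card σ ^ T.ncard := by
  rw [← Nat.card_coe_set_eq, ← Nat.card_coe_set_eq T, ← Nat.card_fun]
  refine Nat.card_le_card_of_injective (fun w (i : T) => w.1 i) fun w w' h => ?_
  ext i
  by_cases hi : i ∈ T
  · exact congrFun h ⟨i, hi⟩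
  · exact (w.2 hi).trans (w'.2 hi).symm

theorem ncard_setOf_natCast_mem_le {K : ℕ} [NeZero K] (T : Set (ZMod K)) (H : ℕ) :
    {ℓ : Fin H | ((ℓ : ℕ) : ZMod K) ∈ T}.ncard ≤ (H / K + 1) * T.ncard := by
  rw [mul_comm, ← Finset.card_range (H / K + 1), ← Set.ncard_coe_finset, ← Set.ncard_prod]
  refine Set.ncard_le_ncard_of_injOn (fun ℓ => (((ℓ : ℕ) : ZMod K), (ℓ : ℕ) / K)) ?_ ?_
  · intro ℓ hℓ
    refine ⟨hℓ, Finset.mem_coe.2 (Finset.mem_range.2 (Nat.lt_succ_of_le ?_))⟩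
    exact Nat.div_le_div_right ℓ.2.le
  · intro ℓ _ ℓ' _ h
    obtain ⟨hmod, hdiv⟩ := Prod.mk.inj h
    rw [ZMod.natCast_eq_natCast_iff'] at hmod
    rw [Fin.ext_iff, ← Nat.div_add_mod ℓ K, ← Nat.div_add_mod ℓ' K, hdiv, hmod]

theorem ncard_initialWords_le [Finite σ] [Nonempty σ] {K E : ℕ} [NeZero K] {𝒮 : Set (ℕ → σ)}
    (h𝒮 : ∀ s ∈ 𝒮, ∃ (u : ZMod K → σ) (T : Set (ZMod K)),
      T.ncard ≤ E ∧ ∀ n : ℕ, (n : ZMod K) ∉ T → s n = u n) (H : ℕ) :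
    (initialWords 𝒮 H).ncard ≤
      Nat.card ((ZMod K → σ) × Set (ZMod K)) * Nat.card σ ^ ((H / K + 1) * E) := by
  set templates : Set ((ZMod K → σ) × Set (ZMod K)) := {t | t.2.ncard ≤ E}
  have := Fintype.ofFinite templates
  set words : (ZMod K → σ) × Set (ZMod K) → Set (Fin H → σ) := fun t =>
    {w | Set.EqOn w (fun ℓ => t.1 (ℓ : ℕ)) {ℓ | ((ℓ : ℕ) : ZMod K) ∈ t.2}ᶜ}
  have hcover : initialWords 𝒮 H ⊆ ⋃ t : templates, words t := by
    rintro _ ⟨s, hs, rfl⟩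
    obtain ⟨u, T, hT, hu⟩ := h𝒮 s hs
    exact Set.mem_iUnion.2 ⟨⟨(u, T), hT⟩, fun ℓ hℓ => hu ℓ hℓ⟩
  calc (initialWords 𝒮 H).ncard ≤ (⋃ t : templates, words t).ncard := Set.ncard_le_ncard hcover
    _ ≤ ∑ t : templates, (words t).ncard := Set.ncard_iUnion_le_of_fintype _
    _ ≤ ∑ _ : templates, Nat.card σ ^ ((H / K + 1) * E) := by
        refine Finset.sum_le_sum fun t _ => (ncard_setOf_eqOn_compl_le _ _).trans ?_
        exact Nat.pow_le_pow_right Nat.card_pos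
          ((ncard_setOf_natCast_mem_le _ H).trans (Nat.mul_le_mul_left _ t.2))
    _ ≤ _ := by
        rw [Finset.sum_const, smul_eq_mul, Finset.card_univ, ← Nat.card_eq_fintype_card]
        exact Nat.mul_le_mul_right _ (Finite.card_subtype_le _)

theorem log_natCast_le_log_natCast {a b : ℕ} (h : a ≤ b) : Real.log a ≤ Real.log b := by
  rcases a.eq_zero_or_pos with rfl | ha
  · simpa using Real.log_natCast_nonneg b
  · exact Real.log_le_log (by exact_mod_cast ha) (by exact_mod_cast h)

theorem tendsto_one_div_mul_nhds_zero {v : ℕ → ℝ} (hv : ∀ H, 0 ≤ v H)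
    (hlin : ∀ ε : ℝ, 0 < ε → ∃ C : ℝ, ∀ H : ℕ, v H ≤ ε * H + C) :
    Filter.Tendsto (fun H : ℕ => 1 / (H : ℝ) * v H) Filter.atTop (nhds 0) := by
  have hlittle : v =o[Filter.atTop] fun H : ℕ => (H : ℝ) := by
    refine Asymptotics.isLittleO_iff.2 fun ε hε => ?_
    obtain ⟨C, hC⟩ := hlin (ε / 2) (half_pos hε)
    filter_upwards [Filter.eventually_ge_atTop ⌈C / (ε / 2)⌉₊] with H hH
    rw [Real.norm_of_nonneg (hv H), Real.norm_of_nonneg H.cast_nonneg]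
    have hCH : C ≤ H * (ε / 2) := (div_le_iff₀ (half_pos hε)).1 (Nat.ceil_le.1 hH)
    linarith [hC H]
  simpa only [one_div_mul_eq_div] using hlittle.tendsto_div_nhds_zero

namespace IsUniformlyRationallyAlmostPeriodic

theorem exists_log_ncard_initialWords_le [Finite σ] [Nonempty σ] {𝒮 : Set (ℕ → σ)}
    (h𝒮 : IsUniformlyRationallyAlmostPeriodic 𝒮) {ε : ℝ} (hε : 0 < ε) :
    ∃ C : ℝ, ∀ H : ℕ, Real.log (initialWords 𝒮 H).ncard ≤ ε * H + C := by
  set b := Real.log (Nat.card σ)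
  have hb : 0 ≤ b := Real.log_natCast_nonneg _
  obtain ⟨K, hK, hcover⟩ := h𝒮 (ε / (b + 1)) (by positivity)
  have : NeZero K := ⟨hK.ne'⟩
  set E := ⌊ε / (b + 1) * K⌋₊
  set N := Nat.card ((ZMod K → σ) × Set (ZMod K))
  have hE : E * b ≤ ε * K := calc
    E * b ≤ ε / (b + 1) * K * (b + 1) :=
      mul_le_mul (Nat.floor_le (by positivity)) (by linarith) hb (by positivity)
    _ = ε * K := by field_simp
  refine ⟨Real.log N + ε * K, fun H => ?_⟩
  have hncard := ncard_initialWords_le (E := E) (fun s hs => by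
    obtain ⟨u, T, hT, hu⟩ := hcover s hs
    exact ⟨u, T, Nat.le_floor hT, hu⟩) H
  have hdiv : ((H / K : ℕ) : ℝ) * K ≤ H := by exact_mod_cast Nat.div_mul_le_self H K
  calc Real.log (initialWords 𝒮 H).ncard
      ≤ Real.log (N * Nat.card σ ^ ((H / K + 1) * E) : ℕ) := log_natCast_le_log_natCast hncard
    _ = Real.log N + ((H / K : ℕ) + 1) * (E * b) := by
        have hN : (N : ℝ) ≠ 0 := by exact_mod_cast Nat.card_pos.ne'
        have hσ : (Nat.card σ : ℝ) ≠ 0 := by exact_mod_cast Nat.card_pos.ne'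
        push_cast
        rw [Real.log_mul hN (pow_ne_zero _ hσ), Real.log_pow]
        push_cast
        ring
    _ ≤ Real.log N + ((H / K : ℕ) + 1) * (ε * K) := by gcongr
    _ ≤ ε * H + (Real.log N + ε * K) := by nlinarith

theorem tendsto_log_ncard_initialWords [Finite σ] [Nonempty σ] {𝒮 : Set (ℕ → σ)}
    (h𝒮 : IsUniformlyRationallyAlmostPeriodic 𝒮) :
    Filter.Tendsto (fun H : ℕ => 1 / (H : ℝ) * Real.log (initialWords 𝒮 H).ncard)
      Filter.atTop (nhds 0) :=
  tendsto_one_div_mul_nhds_zero (fun _ => Real.log_natCast_nonneg _)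
    fun _ => h𝒮.exists_log_ncard_initialWords_le

end IsUniformlyRationallyAlmostPeriodic

end AlmostPeriodicity

section PolynomialSequences

open Polynomial

/-- The sequences `a(P(0)), a(P(1)), …`, where `P` is an integer polynomial of degree at most `d`
that maps `ℕ` to `ℕ`. -/
def polynomialSequences {A : Type*} (a : ℕ → A) (d : ℕ) : Set (ℕ → A) :=
  (fun P n => a (P.eval (n : ℤ)).toNat) '' natValuedPolynomials d

theorem polynomialSubwords_eq_initialWords {A : Type*} (a : ℕ → A) (d H : ℕ) :
    polynomialSubwords a d H = initialWords (polynomialSequences a d) H := by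
  ext w
  constructor
  · rintro ⟨n, P, hP, rfl⟩
    refine ⟨_, ⟨_, comp_X_add_C_mem_natValuedPolynomials hP n, rfl⟩, ?_⟩
    simp [add_comm]
  · rintro ⟨_, ⟨P, hP, rfl⟩, rfl⟩
    exact ⟨0, P, hP, by simp⟩

theorem polynomialSubwords_comp {σ A : Type*} (out : σ → A) (S : ℕ → σ) (d H : ℕ) :
    polynomialSubwords (out ∘ S) d H = (out ∘ ·) '' polynomialSubwords S d H := by
  ext w
  constructor
  · rintro ⟨n, P, hP, rfl⟩
    exact ⟨_, ⟨n, P, hP, rfl⟩, rfl⟩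
  · rintro ⟨_, ⟨n, P, hP, rfl⟩, rfl⟩
    exact ⟨n, P, hP, rfl⟩

theorem eval_modEq_of_modEq {Q : ℤ[X]} {f : ℕ → ℕ} (hf : ∀ n : ℕ, (f n : ℤ) = Q.eval (n : ℤ))
    {m a b : ℕ} (h : a ≡ b [MOD m]) : f a ≡ f b [MOD m] := by
  rw [Nat.modEq_iff_dvd, hf, hf]
  exact (Nat.modEq_iff_dvd.1 h).trans (sub_dvd_eval_sub _ _ Q)

theorem ncard_setOf_val_le {K : ℕ} [NeZero K] (p : ℕ → Prop) [DecidablePred p] :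
    {r : ZMod K | p r.val}.ncard ≤ Nat.count p K := by
  rw [Nat.count_eq_card_filter_range, ← Set.ncard_coe_finset]
  refine Set.ncard_le_ncard_of_injOn ZMod.val (fun r hr => ?_) (ZMod.val_injective K).injOn
  simpa [ZMod.val_lt r] using hr

theorem exists_stateAt_eval_eq {k d : ℕ} {σ A : Type*}
    {M : OutputAutomaton (Fin k) σ A} (hM : M.IgnoresLeadingZeros) (hk : 2 ≤ k) {P : ℤ[X]}
    (hP : P ∈ natValuedPolynomials d) (hdeg : P.natDegree ≠ 0) :
    ∃ (F : σ → σ) (Q : ℤ[X]), Q ∈ natValuedPolynomials d ∧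
      (∃ i, i ≠ 0 ∧ ¬ (k : ℤ) ∣ Q.coeff i) ∧
      ∀ n : ℕ, M.stateAt hk (P.eval (n : ℤ)).toNat = F (M.stateAt hk (Q.eval (n : ℤ)).toNat) := by
  obtain ⟨m, c, Q, hc, rfl, hi⟩ := exists_eq_C_add_C_pow_mul hk hdeg
  have hQ : Q ∈ natValuedPolynomials d :=
    mem_natValuedPolynomials_of_C_add_C_mul hc (by exact_mod_cast hP)
  obtain ⟨F, hF⟩ := hM.exists_stateAt_pow_mul_add hk hc
  refine ⟨F, Q, hQ, hi, fun n => ?_⟩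
  rw [← hF]
  congr 1
  zify
  rw [Int.toNat_of_nonneg (hP.2 n), Int.toNat_of_nonneg (hQ.2 n)]
  simp [add_comm]

theorem isUniformlyRationallyAlmostPeriodic_polynomialSequences {k : ℕ} {σ A : Type*}
    {M : OutputAutomaton (Fin k) σ A} (hM : M.IgnoresLeadingZeros) (hk : 2 ≤ k)
    {w : List (Fin k)} (hw : M.IsSynchronizingWord w) (d : ℕ) :
    IsUniformlyRationallyAlmostPeriodic (polynomialSequences (M.stateAt hk) d) := by
  classical
  intro δ hδ
  obtain ⟨m, hm⟩ := exists_count_not_hasBlock_le (by lia) (appendDigits_zero_lt w) d hδ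
  have : NeZero (k ^ m) := ⟨by positivity⟩
  refine ⟨k ^ m, by positivity, ?_⟩
  rintro _ ⟨P, hP, rfl⟩
  by_cases hdeg : P.natDegree = 0
  · rw [eq_C_of_natDegree_eq_zero hdeg]
    exact ⟨fun _ => M.stateAt hk (P.coeff 0).toNat, ∅,
      by rw [Set.ncard_empty, Nat.cast_zero]; positivity, by simp⟩
  obtain ⟨F, Q, hQ, hi, hF⟩ := exists_stateAt_eval_eq hM hk hP hdeg
  set f : ℕ → ℕ := fun n => (Q.eval (n : ℤ)).toNat
  have hf : ∀ n : ℕ, (f n : ℤ) = Q.eval (n : ℤ) := fun n => Int.toNat_of_nonneg (hQ.2 n)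
  have hperiodic : ∀ n : ℕ, f (n : ZMod (k ^ m)).val ≡ f n [MOD k ^ m] := fun n =>
    eval_modEq_of_modEq hf (by rw [ZMod.val_natCast]; exact Nat.mod_modEq n _)
  set blockFree : ℕ → Prop := fun n => ¬ HasBlock k w.length (appendDigits 0 w) m (f n)
  refine ⟨fun r => F (M.stateAt hk (f r.val)), {r | blockFree r.val}, ?_, fun n hn => ?_⟩
  · calc ({r : ZMod (k ^ m) | blockFree r.val}.ncard : ℝ) ≤ Nat.count blockFree (k ^ m) := by
          exact_mod_cast ncard_setOf_val_le blockFree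
      _ ≤ δ * (k ^ m : ℕ) := hm Q f hf (natDegree_le_of_degree_le hQ.1) hi
  · exact (hF n).trans
      (congrArg F (hM.stateAt_eq_of_modEq hk hw (hperiodic n) (not_not.1 hn)).symm)

end PolynomialSequences

theorem mainTheorem8 {A : Type*} (k : ℕ) (hk : 2 ≤ k) (a : ℕ → A)
    (ha : IsSynchronizingAutomatic k hk a) (d : ℕ) :
    (∀ H : ℕ, (polynomialSubwords a d H).Finite) ∧
      Filter.Tendsto
        (fun H : ℕ => (1 / (H : ℝ)) * Real.log ((polynomialSubwords a d H).ncard : ℝ))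
        Filter.atTop (nhds 0) := by
  obtain ⟨σ, _, M, hMa, hM, w, hw⟩ := ha.exists_ignoresLeadingZeros
  have : Nonempty σ := ⟨M.start⟩
  obtain rfl : M.output ∘ M.stateAt hk = a := funext hMa
  have hperiodic := isUniformlyRationallyAlmostPeriodic_polynomialSequences hM hk hw d
  have himage : ∀ H, polynomialSubwords (M.output ∘ M.stateAt hk) d H =
      (M.output ∘ ·) '' initialWords (polynomialSequences (M.stateAt hk) d) H := fun H => by
    rw [polynomialSubwords_comp, polynomialSubwords_eq_initialWords]
  simp only [himage]
  refine ⟨fun H => (Set.toFinite _).image _,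
    squeeze_zero (fun H => ?_) (fun H => ?_) hperiodic.tendsto_log_ncard_initialWords⟩
  · exact mul_nonneg (by positivity) (Real.log_natCast_nonneg _)
  · exact mul_le_mul_of_nonneg_left (log_natCast_le_log_natCast Set.ncard_image_le) (by positivity)
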